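/- For integers $m\ge 3$ and $c$ let $P(m,c)=\frac{c}{2}\{(m-2)c-(m-4)\}$ be the $c$-th $m$-gonal number, where the index $c$ ranges over the positive integers if $m\in\{3,4\}$ and over all integers if $m>4$. For positive integers $n$ and $t$, let $r_{m,t}(n)$ be the number of representations $n=a+b$ with positive integers $a,b$ (the order of the summands being disregarded) such that $ab=tP(m,c)$ for some such index $c$. For a positive integer $z$ let $d(z)$ be the number of positive divisors of $z$, and for a finite set $A$ of primes let $d_A(z)=\prod_{p\notin A}(1+\mathrm{ord}_p z)$, the product being over the primes $p\notin A$, where $p^{\mathrm{ord}_p z}$ is the exact power of $p$ dividing $z$. Then for every positive integer $n$: \begin{enumerate} \item $r_{3,1}(n)=\lfloor (d(2n^2+1)-1)/2 \rfloor$; \item $r_{5,1}(n)=\lfloor (d(6n^2+1)-1)/2 \rfloor$; \item $r_{7,1}(n)=\lfloor (d_{\{3\}}(10n^2+9)-1)/2 \rfloor$; \item $r_{13,1}(n)=\lfloor (d_{\{3\}}(22n^2+81)-1)/2 \rfloor$; \item $r_{31,1}(n)=\lfloor (d_{\{3\}}(58n^2+729)-1)/2 \rfloor$; \item $r_{3,2}(n)=d(n^2+1)/2-1$;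 \item $r_{8,2}(n)=\lfloor (d_{\{2\}}(3n^2+8)-1)/2 \rfloor$; \item $r_{12,2}(n)=\lfloor (d_{\{2\}}(5n^2+32)-1)/2 \rfloor$; \item $r_{24,2}(n)=\lfloor (d_{\{2,5\}}(11n^2+200)-1)/2 \rfloor$; \item $r_{60,2}(n)=\lfloor (d_{\{2,7\}}(29n^2+1568)-1)/2 \rfloor$; \item $r_{3,3}(n)=\lfloor (d_{\{3\}}(2n^2+3)-1)/2 \rfloor$; \item $r_{3,5}(n)=\lfloor (d_{\{5\}}(2n^2+5)-1)/2 \rfloor$; \item $r_{3,11}(n)=\lfloor (d_{\{11\}}(2n^2+11)-1)/2 \rfloor$; \item $r_{3,29}(n)=\lfloor (d_{\{29\}}(2n^2+29)-1)/2 \rfloor$. \end{enumerate} -/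

import Mathlib

/-- The `c`-th `m`-gonal number `P(m, c) = (c / 2) * ((m - 2) * c - (m - 4))`.
The integer division by `2` is exact, see `two_mul_polygonal`. -/
def polygonal (m : ℕ) (c : ℤ) : ℤ :=
  c * (((m : ℤ) - 2) * c - ((m : ℤ) - 4)) / 2

theorem two_mul_polygonal (m : ℕ) (c : ℤ) :
    2 * polygonal m c = c * (((m : ℤ) - 2) * c - ((m : ℤ) - 4)) := by
  unfold polygonal
  apply Int.mul_ediv_cancel'
  rcases Int.even_or_odd' c with ⟨k, rfl | rfl⟩
  · exact ⟨k * (((m : ℤ) - 2) * (2 * k) - ((m : ℤ) - 4)), by ring⟩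
  · exact ⟨(2 * k + 1) * (((m : ℤ) - 2) * k + 1), by ring⟩

/-- The indices of `m`-gonal numbers: positive integers if `m ≤ 4`, all integers if `m > 4`. -/
def IsPolygonalIndex (m : ℕ) (c : ℤ) : Prop :=
  m ≤ 4 → 0 < c

/-- The representations `n = a + b` with `a`, `b` positive integers (the order of the summands
being disregarded, which is normalized by `a ≤ b`) such that `a * b = t * P(m, c)` for some
index `c`. -/
def polygonalReps (m t n : ℕ) : Set (ℕ × ℕ) :=
  {q | 0 < q.1 ∧ q.1 ≤ q.2 ∧ n = q.1 + q.2 ∧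
    ∃ c : ℤ, IsPolygonalIndex m c ∧ (q.1 : ℤ) * (q.2 : ℤ) = (t : ℤ) * polygonal m c}

/-- A set of such representations is finite, so that its `Set.ncard` is its number of elements. -/
theorem polygonalReps_finite (m t n : ℕ) : (polygonalReps m t n).Finite := by
  apply (Set.finite_Iic ((n, n) : ℕ × ℕ)).subset
  rintro ⟨a, b⟩ ⟨_, _, h, _⟩
  simp only at h
  exact Set.mem_Iic.2 (Prod.mk_le_mk.2 ⟨by omega, by omega⟩)

/-- `r_{m,t}(n)`: the number of representations `n = a + b` with `a * b = t * P(m, c)`. -/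
noncomputable def polygonalRepCount (m t n : ℕ) : ℕ :=
  (polygonalReps m t n).ncard

/-- `d_A(z) = ∏_{p ∉ A} (1 + ord_p z)`, for a positive integer `z`. Only the primes `p` that
divide `z` contribute a factor other than `1`. -/
def numDivisorsAway (A : Finset ℕ) (z : ℕ) : ℕ :=
  ∏ p ∈ z.primeFactors \ A, (1 + z.factorization p)

/-!
Completing the square in `n ^ 2 - (b - a) ^ 2 = 4 * t * P(m, c)` turns the decompositions of `n`
into the representations of a fixed `N` by a diagonal form `u * x ^ 2 + v * y ^ 2`, one
representation `p` being given by `c = 0`. If `N` is prime to `2 * u * v`, every representation `q`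
induces a factorization `N = d * e` by `d = gcd (det(q, p), N)`. Conversely, the vectors whose
determinant with `p` vanishes modulo `d`, and whose determinant with the conjugate of `p` vanishes
modulo `e`, form a lattice of index `N` on which the form is `N` times a form of determinant
`u * v`. That form lies in the principal genus, so if this genus has a single class, its minimum
is `1`, and it is attained exactly twice. Hence `N` has `2 * d(N)` representations. A prime `q` in
the exceptional set is ramified or inert: in the first case it can be moved from `N` into the
coefficients of the form, in the second case `q ^ 2` can be cancelled, and neither changes the
number of representations.
-/

/-- The diagonal binary quadratic form `u * x ^ 2 + v * y ^ 2`; the decompositions counted by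
`polygonalRepCount` are turned into its representations of a fixed number. -/
def diagForm (u v : ℤ) (q : ℤ × ℤ) : ℤ :=
  u * q.1 ^ 2 + v * q.2 ^ 2

/-- The polar form of `diagForm u v`, normalized so that `diagBilin u v q q = diagForm u v q`. -/
def diagBilin (u v : ℤ) (q r : ℤ × ℤ) : ℤ :=
  u * q.1 * r.1 + v * q.2 * r.2

/-- The determinant of the pair of plane vectors `q`, `r`, used for indices of sublattices of
`ℤ × ℤ`. -/
def planeDet (q r : ℤ × ℤ) : ℤ :=
  q.1 * r.2 - r.1 * q.2

section Forms

variable (u v : ℤ) (q r : ℤ × ℤ)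

theorem diagForm_add :
    diagForm u v (q + r) = diagForm u v q + diagForm u v r + 2 * diagBilin u v q r := by
  simp only [diagForm, diagBilin, Prod.fst_add, Prod.snd_add]; ring

theorem diagForm_sub :
    diagForm u v (q - r) = diagForm u v q + diagForm u v r - 2 * diagBilin u v q r := by
  simp only [diagForm, diagBilin, Prod.fst_sub, Prod.snd_sub]; ring

theorem diagForm_neg : diagForm u v (-q) = diagForm u v q := by
  simp only [diagForm, Prod.fst_neg, Prod.snd_neg, neg_sq]

theorem diagForm_swap : diagForm u v q.swap = diagForm v u q := by
  simp only [diagForm, Prod.fst_swap, Prod.snd_swap, add_comm]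

theorem diagBilin_comm : diagBilin u v q r = diagBilin u v r q := by
  simp only [diagBilin]; ring

theorem diagBilin_neg_right : diagBilin u v q (-r) = -diagBilin u v q r := by
  simp only [diagBilin, Prod.fst_neg, Prod.snd_neg]; ring

theorem diagForm_mul_diagForm :
    diagForm u v q * diagForm u v r = diagBilin u v q r ^ 2 + u * v * planeDet q r ^ 2 := by
  simp only [diagForm, diagBilin, planeDet]; ring

variable {u v} {q}

theorem diagForm_nonneg (hu : 0 ≤ u) (hv : 0 ≤ v) : 0 ≤ diagForm u v q := by
  unfold diagForm; positivity

theorem eq_zero_of_diagForm_eq_zero (hu : 0 < u) (hv : 0 < v) (h : diagForm u v q = 0) :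
    q = 0 := by
  obtain ⟨hx, hy⟩ := (add_eq_zero_iff_of_nonneg (by positivity) (by positivity)).1 h
  ext
  · simpa [hu.ne'] using hx
  · simpa [hv.ne'] using hy

theorem isCoprime_diagForm (h : IsCoprime (u * q.1) (v * q.2)) :
    IsCoprime (diagForm u v q) (u * v * (q.1 * q.2)) := by
  have hxy : IsCoprime (u * q.1 ^ 2) (v * q.2 ^ 2) :=
    ((h.pow (m := 2) (n := 2)).of_isCoprime_of_dvd_left ⟨u, by ring⟩).of_isCoprime_of_dvd_right
      ⟨v, by ring⟩
  have hsum : IsCoprime (diagForm u v q) (u * q.1 ^ 2 * (v * q.2 ^ 2)) := by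
    refine .mul_right ?_ ?_ <;> unfold diagForm
    · simpa [add_comm] using hxy.symm.add_mul_left_left 1
    · simpa using hxy.add_mul_right_left 1
  exact hsum.of_isCoprime_of_dvd_right ⟨q.1 * q.2, by ring⟩

end Forms

/-- The lattice that splits the factorization `d * e` of the number represented at `p`: it plays
the role of an ideal of norm `d * e`, the first congruence being modulo `d` and the conjugate one
modulo `e`. -/
def splitLattice (p : ℤ × ℤ) (d e : ℤ) : AddSubgroup (ℤ × ℤ) where
  carrier := {q | d ∣ planeDet q p ∧ e ∣ q.1 * p.2 + p.1 * q.2}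
  zero_mem' := by simp [planeDet]
  add_mem' := by
    rintro q r ⟨hqd, hqe⟩ ⟨hrd, hre⟩
    refine ⟨(dvd_add hqd hrd).trans (dvd_of_eq ?_), (dvd_add hqe hre).trans (dvd_of_eq ?_)⟩ <;>
      simp only [planeDet, Prod.fst_add, Prod.snd_add] <;> ring
  neg_mem' := by
    rintro q ⟨hqd, hqe⟩
    refine ⟨(dvd_neg.2 hqd).trans (dvd_of_eq ?_), (dvd_neg.2 hqe).trans (dvd_of_eq ?_)⟩ <;>
      simp only [planeDet, Prod.fst_neg, Prod.snd_neg] <;> ring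

section Lattice

variable {u v d e : ℤ} {p q r : ℤ × ℤ}

theorem mem_splitLattice :
    q ∈ splitLattice p d e ↔ d ∣ planeDet q p ∧ e ∣ q.1 * p.2 + p.1 * q.2 :=
  Iff.rfl

theorem dvd_diagForm_of_mem_splitLattice (hde : d * e = diagForm u v p)
    (hp : IsCoprime (d * e) p.2) (hq : q ∈ splitLattice p d e) : d * e ∣ diagForm u v q := by
  have hprod : d * e ∣ planeDet q p * (q.1 * p.2 + p.1 * q.2) := mul_dvd_mul hq.1 hq.2
  refine (hp.pow_right (n := 2)).dvd_of_dvd_mul_left ?_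
  refine (dvd_add (hprod.mul_left u) (dvd_mul_right (d * e) (q.2 ^ 2))).trans (dvd_of_eq ?_)
  simp only [hde, diagForm, planeDet]
  ring

theorem dvd_diagBilin_of_mem_splitLattice (hde : d * e = diagForm u v p)
    (hp : IsCoprime (d * e) p.2) (h2 : IsCoprime (d * e) 2) (hq : q ∈ splitLattice p d e)
    (hr : r ∈ splitLattice p d e) : d * e ∣ diagBilin u v q r := by
  have hsum := dvd_diagForm_of_mem_splitLattice hde hp (add_mem hq hr)
  rw [diagForm_add] at hsum
  exact h2.dvd_of_dvd_mul_left <| (dvd_add_right <| dvd_add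
    (dvd_diagForm_of_mem_splitLattice hde hp hq)
    (dvd_diagForm_of_mem_splitLattice hde hp hr)).1 hsum

theorem exists_mem_splitLattice_planeDet_eq (hd : 0 < d) (hp : IsCoprime (d * e) p.2) :
    ∃ q ∈ splitLattice p d e, ∃ r ∈ splitLattice p d e, planeDet q r = d * e := by
  obtain ⟨d', e', hco, hd', he'⟩ := Int.exists_gcd_one (Int.gcd_pos_of_ne_zero_left e hd.ne')
  generalize (Int.gcd d e : ℤ) = g at hd' he'
  obtain ⟨a, b, hab⟩ := Int.isCoprime_iff_gcd_eq_one.2 hco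
  obtain ⟨i, j, hij⟩ := hp
  subst hd' he'
  -- The second vector is `(g * x, g)`, where `x` solves `x * p.2 ≡ p.1` modulo `d'` and
  -- `x * p.2 ≡ -p.1` modulo `e'`.
  refine ⟨(g * d' * e', 0), ⟨⟨e' * p.2, ?_⟩, ⟨d' * p.2, by ring⟩⟩,
    (g * (j * p.1 * (b * e' - a * d')), g), ⟨?_, ?_⟩, ?_⟩
  · simp only [planeDet]; ring
  · refine ⟨-(2 * a * j * p.2 * p.1) - p.1 * i * g * g * e', ?_⟩
    simp only [planeDet]
    linear_combination (g * p.1 * j * p.2) * hab + g * p.1 * hij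
  · refine ⟨2 * b * j * p.2 * p.1 + p.1 * i * g * g * d', ?_⟩
    linear_combination (-g * p.1 * j * p.2) * hab - g * p.1 * hij
  · simp only [planeDet]; ring

theorem exists_reduced_pair (hu : 0 < u) (hv : 0 < v) {L : AddSubgroup (ℤ × ℤ)} (hq : q ∈ L)
    (hr : r ∈ L) :
    ∃ q' ∈ L, ∃ r' ∈ L, planeDet q' r' = planeDet q r ∧
      2 * |diagBilin u v q' r'| ≤ diagForm u v q' ∧ diagForm u v q' ≤ diagForm u v r' := by
  let T : Set ((ℤ × ℤ) × (ℤ × ℤ)) :=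
    {b | b.1 ∈ L ∧ b.2 ∈ L ∧ planeDet b.1 b.2 = planeDet q r}
  obtain ⟨⟨q', r'⟩, ⟨hq', hr', hdet⟩, hmin⟩ := (measure fun b : (ℤ × ℤ) × (ℤ × ℤ) =>
    (diagForm u v b.1 + diagForm u v b.2).toNat).wf.has_min T ⟨(q, r), hq, hr, rfl⟩
  have hle : ∀ q₁ ∈ L, ∀ r₁ ∈ L, planeDet q₁ r₁ = planeDet q' r' →
      diagForm u v q' + diagForm u v r' ≤ diagForm u v q₁ + diagForm u v r₁ := by
    intro q₁ hq₁ r₁ hr₁ h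
    have hnlt : ¬ (diagForm u v q₁ + diagForm u v r₁).toNat <
      (diagForm u v q' + diagForm u v r').toNat := hmin (q₁, r₁) ⟨hq₁, hr₁, h.trans hdet⟩
    have := diagForm_nonneg (q := q₁) hu.le hv.le
    have := diagForm_nonneg (q := r₁) hu.le hv.le
    omega
  have hcomm := diagBilin_comm u v r' q'
  have h₁ := hle q' hq' (r' + q') (add_mem hr' hq')
    (by simp only [planeDet, Prod.fst_add, Prod.snd_add]; ring)
  have h₂ := hle q' hq' (r' - q') (sub_mem hr' hq')
    (by simp only [planeDet, Prod.fst_sub, Prod.snd_sub]; ring)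
  have h₃ := hle (q' + r') (add_mem hq' hr') r' hr'
    (by simp only [planeDet, Prod.fst_add, Prod.snd_add]; ring)
  have h₄ := hle (q' - r') (sub_mem hq' hr') r' hr'
    (by simp only [planeDet, Prod.fst_sub, Prod.snd_sub]; ring)
  rw [diagForm_add] at h₁ h₃
  rw [diagForm_sub] at h₂ h₄
  rcases le_total (diagForm u v q') (diagForm u v r') with hqr | hrq
  · refine ⟨q', hq', r', hr', hdet, ?_, hqr⟩
    rcases abs_cases (diagBilin u v q' r') with h | h <;> linarith
  · refine ⟨r', hr', -q', neg_mem hq', ?_, ?_, by rwa [diagForm_neg]⟩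
    · rw [← hdet]
      simp only [planeDet, Prod.fst_neg, Prod.snd_neg]
      ring
    · rw [diagBilin_neg_right, hcomm, abs_neg]
      rcases abs_cases (diagBilin u v q' r') with h | h <;> linarith

end Lattice

/-- Every form `a * x ^ 2 + 2 * b * x * y + c * y ^ 2` of determinant `k` that is reduced in the
sense of Gauss either is the principal one, `a = 1`, or does not belong to the principal genus,
because no square prime to `2 * k` multiplies its value `a` to a value of the principal form. -/
def OneClassInPrincipalGenus (k : ℤ) : Prop :=
  ∀ a b c : ℤ, 0 < a → a ≤ c → 2 * |b| ≤ a → a * c - b ^ 2 = k →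
    a = 1 ∨ ∀ B D N : ℤ, IsCoprime N (2 * k) → B ^ 2 + k * D ^ 2 ≠ a * N ^ 2

section SplitLattice

variable {u v d e : ℤ} {p q r : ℤ × ℤ}

theorem exists_mem_splitLattice_diagForm_eq (hu : 0 < u) (hv : 0 < v) (hd : 0 < d) (he : 0 < e)
    (hde : d * e = diagForm u v p) (hp : IsCoprime (d * e) p.2)
    (hk : IsCoprime (d * e) (2 * (u * v))) (hcl : OneClassInPrincipalGenus (u * v)) :
    ∃ q ∈ splitLattice p d e, diagForm u v q = d * e := by
  have hN : 0 < d * e := mul_pos hd he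
  obtain ⟨q₀, hq₀, r₀, hr₀, hdet₀⟩ := exists_mem_splitLattice_planeDet_eq hd hp
  obtain ⟨q, hq, r, hr, hdet, hqr, hqr'⟩ := exists_reduced_pair hu hv hq₀ hr₀
  obtain ⟨a, ha⟩ := dvd_diagForm_of_mem_splitLattice hde hp hq
  obtain ⟨c, hc⟩ := dvd_diagForm_of_mem_splitLattice hde hp hr
  obtain ⟨b, hb⟩ := dvd_diagBilin_of_mem_splitLattice hde hp hk.of_mul_right_left hq hr
  have habc : a * c - b ^ 2 = u * v := by
    have hmul := diagForm_mul_diagForm u v q r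
    rw [hdet, hdet₀, ha, hc, hb] at hmul
    exact mul_left_cancel₀ (pow_ne_zero 2 hN.ne') (by linear_combination hmul)
  have hba : 2 * |b| ≤ a := by
    rw [ha, hb, abs_mul, abs_of_pos hN] at hqr
    exact le_of_mul_le_mul_left (by linarith) hN
  have hac : a ≤ c := by
    rw [ha, hc] at hqr'
    exact le_of_mul_le_mul_left hqr' hN
  have ha0 : 0 < a := by nlinarith [abs_nonneg b, sq_nonneg b, mul_pos hu hv]
  rcases hcl a b c ha0 hac hba habc with rfl | hgenus
  · exact ⟨q, hq, by rw [ha, mul_one]⟩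
  · have hmul := diagForm_mul_diagForm u v p q
    rw [ha, ← hde] at hmul
    exact absurd (by linear_combination -hmul)
      (hgenus (diagBilin u v p q) (planeDet p q) (d * e) hk)

theorem eq_or_eq_neg_of_mem_splitLattice (hu : 0 < u) (hv : 0 < v) (huv : u * v ≠ 1)
    (hd : 0 < d) (he : 0 < e) (hde : d * e = diagForm u v p) (hp : IsCoprime (d * e) p.2)
    (hk : IsCoprime (d * e) (2 * (u * v))) (hq : q ∈ splitLattice p d e)
    (hr : r ∈ splitLattice p d e) (hqN : diagForm u v q = d * e)
    (hrN : diagForm u v r = d * e) : q = r ∨ q = -r := by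
  have hk0 : 0 < u * v := mul_pos hu hv
  obtain ⟨b, hb⟩ := dvd_diagBilin_of_mem_splitLattice hde hp hk.of_mul_right_left hq hr
  have hmul := diagForm_mul_diagForm u v q r
  rw [hqN, hrN, hb] at hmul
  have hb1 : b ^ 2 ≤ 1 := by
    refine le_of_mul_le_mul_left (a := (d * e) ^ 2) ?_ (by positivity)
    have : 0 ≤ u * v * planeDet q r ^ 2 := by positivity
    linarith
  obtain rfl | rfl | rfl : b = -1 ∨ b = 0 ∨ b = 1 := by
    have := abs_le.1 ((sq_le_one_iff_abs_le_one b).1 hb1)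
    omega
  · refine Or.inr (eq_neg_of_add_eq_zero_left (eq_zero_of_diagForm_eq_zero hu hv ?_))
    rw [diagForm_add, hqN, hrN, hb]
    ring
  · have hunit := (hk.of_mul_right_right.pow_left (m := 2)).isUnit_of_dvd'
      ⟨planeDet q r ^ 2, by linear_combination hmul⟩ dvd_rfl
    rcases Int.isUnit_iff.1 hunit with h | h <;> omega
  · refine Or.inl (sub_eq_zero.1 (eq_zero_of_diagForm_eq_zero hu hv ?_))
    rw [diagForm_sub, hqN, hrN, hb]
    ring

theorem dvd_planeDet_mul {N : ℤ} (hu : IsCoprime N u) (hpN : diagForm u v p = N)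
    (hqN : diagForm u v q = N) : N ∣ planeDet q p * (q.1 * p.2 + p.1 * q.2) := by
  refine hu.dvd_of_dvd_mul_left ⟨p.2 ^ 2 - q.2 ^ 2, ?_⟩
  simp only [diagForm, planeDet] at *
  linear_combination p.2 ^ 2 * hqN - q.2 ^ 2 * hpN

theorem mul_dvd_of_mem_splitLattice {N : ℤ} (h2p : IsCoprime N (2 * (p.1 * p.2)))
    (hpN : diagForm u v p = N) (hqN : diagForm u v q = N) (hd : d ∣ N) (he : e ∣ N)
    (hq : q ∈ splitLattice p d e) : d * e ∣ N := by
  obtain ⟨hqd, hqe⟩ := hq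
  have hp : IsCoprime N p.2 := h2p.of_mul_right_right.of_mul_right_right
  have hdB : d ∣ u * q.1 * p.1 + v * q.2 * p.2 := by
    refine (hp.of_isCoprime_of_dvd_left hd).dvd_of_dvd_mul_left ?_
    refine (dvd_add (hqd.mul_left (u * p.1)) (hd.mul_left q.2)).trans (dvd_of_eq ?_)
    simp only [← hpN, diagForm, planeDet]; ring
  have heB : e ∣ u * q.1 * p.1 - v * q.2 * p.2 := by
    refine (hp.of_isCoprime_of_dvd_left he).dvd_of_dvd_mul_left ?_
    refine (dvd_sub (hqe.mul_left (u * p.1)) (he.mul_left q.2)).trans (dvd_of_eq ?_)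
    simp only [← hpN, diagForm]; ring
  have hmul : d * e ∣ 2 * (p.1 * p.2) * N := by
    refine (dvd_add (mul_dvd_mul hdB hqe) (mul_dvd_mul hqd heB)).trans (dvd_of_eq ?_)
    simp only [← hqN, diagForm, planeDet]; ring
  exact ((h2p.of_isCoprime_of_dvd_left hd).mul_left
    (h2p.of_isCoprime_of_dvd_left he)).dvd_of_dvd_mul_left hmul

theorem gcd_planeDet_eq_iff {d e : ℕ} (he : e ≠ 0) (hd : d ≠ 0)
    (hu : IsCoprime (d * e : ℤ) u) (h2p : IsCoprime (d * e : ℤ) (2 * (p.1 * p.2)))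
    (hpN : diagForm u v p = d * e) (hqN : diagForm u v q = d * e) :
    Int.gcd (planeDet q p) (d * e) = d ↔ q ∈ splitLattice p d e := by
  constructor
  · intro h
    have hd' : (d : ℤ) ∣ planeDet q p := by
      conv_lhs => rw [← h]
      exact Int.gcd_dvd_left ..
    refine ⟨hd', ?_⟩
    have hdvd := dvd_gcd_mul_of_dvd_mul (dvd_planeDet_mul hu hpN hqN)
    rw [← Int.coe_gcd, Int.gcd_comm, h] at hdvd
    exact Int.dvd_of_mul_dvd_mul_left (by exact_mod_cast hd) hdvd
  · intro h
    set g := Int.gcd (planeDet q p) (d * e)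
    set g' := Int.gcd (q.1 * p.2 + p.1 * q.2) (d * e)
    have hdg : d ∣ g := Int.dvd_gcd h.1 (dvd_mul_right _ _)
    have heg : e ∣ g' := Int.dvd_gcd h.2 (dvd_mul_left _ _)
    have hgg : g * g' ∣ d * e := by
      exact_mod_cast mul_dvd_of_mem_splitLattice h2p hpN hqN (Int.gcd_dvd_right ..)
        (Int.gcd_dvd_right ..) (mem_splitLattice.2 ⟨Int.gcd_dvd_left .., Int.gcd_dvd_left ..⟩)
    have hgd : g * e ∣ d * e := (mul_dvd_mul_left g heg).trans hgg
    exact Nat.dvd_antisymm (Nat.dvd_of_mul_dvd_mul_right (Nat.pos_of_ne_zero he) hgd) hdg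

end SplitLattice

theorem ncard_eq_mul_ncard_of_fiber {α β : Type*} {S : Set α} {T : Set β} {f : α → β} {w : ℕ}
    (hS : S.Finite) (hT : T.Finite) (hf : Set.MapsTo f S T)
    (hfiber : ∀ b ∈ T, {a ∈ S | f a = b}.ncard = w) : S.ncard = w * T.ncard := by
  classical
  lift S to Finset α using hS
  lift T to Finset β using hT
  rw [Set.ncard_coe_finset, Set.ncard_coe_finset, mul_comm,
    Finset.card_eq_sum_card_fiberwise hf, Finset.sum_const_nat]
  intro b hb
  rw [← hfiber b hb, ← Set.ncard_coe_finset]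
  simp

/-- The representations of `N` by `diagForm u v`, all signs being counted. -/
def diagReps (u v N : ℤ) : Set (ℤ × ℤ) :=
  {q | diagForm u v q = N}

section Representations

variable {u v N : ℤ}

theorem mem_diagReps {q : ℤ × ℤ} : q ∈ diagReps u v N ↔ diagForm u v q = N :=
  Iff.rfl

theorem diagReps_finite (hu : 0 < u) (hv : 0 < v) : (diagReps u v N).Finite := by
  apply (Set.finite_Icc ((-N, -N) : ℤ × ℤ) (N, N)).subset
  rintro ⟨x, y⟩ h
  simp only [mem_diagReps, diagForm] at h
  have hx : |x| ≤ N := by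
    rw [← sq_abs x, ← sq_abs y] at h
    nlinarith [Int.le_self_sq |x|, mul_nonneg hv.le (sq_nonneg |y|)]
  have hy : |y| ≤ N := by
    rw [← sq_abs x, ← sq_abs y] at h
    nlinarith [Int.le_self_sq |y|, mul_nonneg hu.le (sq_nonneg |x|)]
  exact ⟨⟨(abs_le.1 hx).1, (abs_le.1 hy).1⟩, (abs_le.1 hx).2, (abs_le.1 hy).2⟩

theorem ncard_diagReps_of_isCoprime {p : ℤ × ℤ} {N : ℕ} (hu : 0 < u) (hv : 0 < v)
    (h2 : 2 ∣ u * v) (hN : N ≠ 0) (hpN : diagForm u v p = N)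
    (hp : IsCoprime (u * p.1) (v * p.2)) (hcl : OneClassInPrincipalGenus (u * v)) :
    (diagReps u v N).ncard = 2 * N.divisors.card := by
  have hcop := hpN ▸ isCoprime_diagForm hp
  have huv : IsCoprime (N : ℤ) (u * v) := hcop.of_mul_right_left
  have hp12 : IsCoprime (N : ℤ) (p.1 * p.2) := hcop.of_mul_right_right
  have hN2 : IsCoprime (N : ℤ) 2 := huv.of_isCoprime_of_dvd_right h2
  rw [← Set.ncard_coe_finset]
  refine ncard_eq_mul_ncard_of_fiber (f := fun q => Int.gcd (planeDet q p) N)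
    (diagReps_finite hu hv) (Finset.finite_toSet _) (fun q _ => ?_) fun d hd => ?_
  · simpa [hN] using Int.natCast_dvd_natCast.1 (Int.gcd_dvd_right (planeDet q p) N)
  · obtain ⟨e, rfl⟩ := Nat.dvd_of_mem_divisors hd
    obtain ⟨hd0, he0⟩ := mul_ne_zero_iff.1 hN
    have hd1 : (0 : ℤ) < d := by positivity
    have he1 : (0 : ℤ) < e := by positivity
    push_cast at *
    have hmem : ∀ q, q ∈ {q ∈ diagReps u v (d * e) | Int.gcd (planeDet q p) (d * e) = d} ↔
        diagForm u v q = d * e ∧ q ∈ splitLattice p d e := fun q =>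
      and_congr_right fun hq => gcd_planeDet_eq_iff he0 hd0 huv.of_mul_right_left
        (hN2.mul_right hp12) hpN hq
    obtain ⟨q, hq, hqN⟩ := exists_mem_splitLattice_diagForm_eq hu hv hd1 he1 hpN.symm
      hp12.of_mul_right_right (hN2.mul_right huv) hcl
    have hq0 : q ≠ -q := by
      intro h
      rw [self_eq_neg] at h
      subst h
      simp [diagForm, hd0, he0, eq_comm] at hqN
    rw [← Set.ncard_pair hq0]
    congr 1
    ext r
    rw [hmem, Set.mem_insert_iff, Set.mem_singleton_iff]
    constructor
    · rintro ⟨hrN, hr⟩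
      exact eq_or_eq_neg_of_mem_splitLattice hu hv (fun h => by omega) hd1 he1 hpN.symm
        hp12.of_mul_right_right (hN2.mul_right huv) hr hq hrN hqN
    · rintro (rfl | rfl)
      · exact ⟨hqN, hq⟩
      · exact ⟨(diagForm_neg ..).trans hqN, neg_mem hq⟩

theorem ncard_diagReps_comm : (diagReps u v N).ncard = (diagReps v u N).ncard :=
  Set.BijOn.ncard_eq (f := Prod.swap) ⟨fun q hq => (diagForm_swap v u q).trans hq,
    Prod.swap_injective.injOn, fun q hq => ⟨q.swap, (diagForm_swap u v q).trans hq, q.swap_swap⟩⟩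

theorem ncard_diagReps_prime_mul {q : ℕ} (hq : q.Prime) (hqv : ¬ (q : ℤ) ∣ v) :
    (diagReps (q * u) v (q * N)).ncard = (diagReps u (q * v) N).ncard := by
  have hq0 : (q : ℤ) ≠ 0 := by exact_mod_cast hq.ne_zero
  symm
  refine Set.BijOn.ncard_eq (f := fun p : ℤ × ℤ => (p.1, q * p.2)) ⟨?_, ?_, ?_⟩
  · rintro p hp
    simp only [mem_diagReps, diagForm] at hp ⊢
    linear_combination q * hp
  · rintro ⟨x, y⟩ _ ⟨x', y'⟩ _ h
    simpa [hq.ne_zero] using h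
  · rintro ⟨x, y⟩ h
    simp only [mem_diagReps, diagForm] at h
    have hqp := Nat.prime_iff_prime_int.1 hq
    have hvy : (q : ℤ) ∣ v * y ^ 2 := ⟨N - u * x ^ 2, by linear_combination h⟩
    obtain ⟨y', rfl⟩ := hqp.dvd_of_dvd_pow ((hqp.dvd_or_dvd hvy).resolve_left hqv)
    refine ⟨(x, y'), mul_left_cancel₀ hq0 ?_, rfl⟩
    simp only [diagForm]
    linear_combination h

theorem ncard_diagReps_sq_mul {q : ℤ} (hq : q ≠ 0)
    (hdvd : ∀ p : ℤ × ℤ, q ∣ diagForm u v p → q ∣ p.1 ∧ q ∣ p.2) :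
    (diagReps u v (q * (q * N))).ncard = (diagReps u v N).ncard := by
  symm
  refine Set.BijOn.ncard_eq (f := fun p : ℤ × ℤ => (q * p.1, q * p.2)) ⟨?_, ?_, ?_⟩
  · rintro p hp
    simp only [mem_diagReps, diagForm] at hp ⊢
    linear_combination q ^ 2 * hp
  · rintro ⟨x, y⟩ _ ⟨x', y'⟩ _ h
    simpa [hq] using h
  · rintro p hp
    obtain ⟨⟨x, hx⟩, ⟨y, hy⟩⟩ := hdvd p ⟨_, hp⟩
    refine ⟨(x, y), mul_left_cancel₀ hq (mul_left_cancel₀ hq ?_), Prod.ext hx.symm hy.symm⟩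
    simp only [mem_diagReps, diagForm, hx, hy] at hp ⊢
    linear_combination hp

end Representations

section DivisorsAway

variable {A : Finset ℕ} {q N : ℕ}

theorem numDivisorsAway_prime_mul (hq : q.Prime) (hqA : q ∈ A) (hN : N ≠ 0) :
    numDivisorsAway A (q * N) = numDivisorsAway A N := by
  unfold numDivisorsAway
  rw [Nat.primeFactors_mul hq.ne_zero hN, hq.primeFactors, Finset.union_sdiff_distrib,
    Finset.sdiff_eq_empty_iff_subset.2 (Finset.singleton_subset_iff.2 hqA), Finset.empty_union]
  refine Finset.prod_congr rfl fun p hp => ?_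
  have hqp : q ≠ p := fun h => (Finset.mem_sdiff.1 hp).2 (h ▸ hqA)
  rw [Nat.factorization_mul hq.ne_zero hN, Finsupp.add_apply, hq.factorization,
    Finsupp.single_eq_of_ne' hqp, zero_add]

theorem numDivisorsAway_eq_card_divisors (hN : N ≠ 0) (h : ∀ q ∈ A, ¬ q ∣ N) :
    numDivisorsAway A N = N.divisors.card := by
  rw [numDivisorsAway, Nat.card_divisors hN, Finset.sdiff_eq_self_of_disjoint]
  · exact Finset.prod_congr rfl fun p _ => add_comm _ _
  · exact Finset.disjoint_left.2 fun p hp hpA => h p hpA (Nat.dvd_of_mem_primeFactors hp)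

theorem numDivisorsAway_empty (hN : N ≠ 0) : numDivisorsAway ∅ N = N.divisors.card :=
  numDivisorsAway_eq_card_divisors hN (by simp)

end DivisorsAway

/-- The integers `a` and `b` have no common prime factor outside `A`. -/
def IsCoprimeAway (A : Finset ℕ) (a b : ℤ) : Prop :=
  ∀ l : ℕ, l.Prime → (l : ℤ) ∣ a → (l : ℤ) ∣ b → l ∈ A

/-- The form `diagForm u v` takes the value `N` at a point at which its two coefficients and
coordinates satisfy the coprimality of `ncard_diagReps_of_isCoprime` away from `A`. -/
def IsValueAway (A : Finset ℕ) (u v N : ℤ) : Prop :=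
  ∃ p, diagForm u v p = N ∧ IsCoprimeAway A (u * p.1) (v * p.2)

/-- The prime `q` does not split in `ℚ(√-k)`: it is either ramified, in the strong sense that it
divides `k` exactly once, or inert. The bound on `x` makes the condition decidable. -/
def IsNonsplitFor (q : ℕ) (k : ℤ) : Prop :=
  ((q : ℤ) ∣ k ∧ ¬ (q : ℤ) ^ 2 ∣ k) ∨ ∀ x < q, ¬ (q : ℤ) ∣ (x : ℤ) ^ 2 + k

instance (q : ℕ) (k : ℤ) : Decidable (IsNonsplitFor q k) :=
  inferInstanceAs (Decidable (_ ∨ _))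

section Descent

variable {A : Finset ℕ} {q : ℕ} {a b u v N : ℤ}

theorem IsCoprimeAway.symm (h : IsCoprimeAway A a b) : IsCoprimeAway A b a :=
  fun l hl ha hb => h l hl hb ha

theorem IsCoprimeAway.of_dvd {a' b' : ℤ} (h : IsCoprimeAway A a b) (ha : a' ∣ a) (hb : b' ∣ b) :
    IsCoprimeAway A a' b' :=
  fun l hl hla hlb => h l hl (hla.trans ha) (hlb.trans hb)

theorem IsCoprimeAway.isCoprime (h : IsCoprimeAway A a b)
    (hA : ∀ q ∈ A, (q : ℤ) ∣ a → ¬ (q : ℤ) ∣ b) : IsCoprime a b := by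
  rw [Int.isCoprime_iff_gcd_eq_one]
  refine Nat.eq_one_iff_not_exists_prime_dvd.2 fun l hl hlg => ?_
  have hla := (Int.natCast_dvd_natCast.2 hlg).trans (Int.gcd_dvd_left a b)
  have hlb := (Int.natCast_dvd_natCast.2 hlg).trans (Int.gcd_dvd_right a b)
  exact hA l (h l hl hla hlb) hla hlb

theorem isCoprimeAway_of_dvd_prod_pow (hA : ∀ q ∈ A, q.Prime) {j : ℕ}
    (ha : a ∣ (∏ q ∈ A, (q : ℤ)) ^ j) : IsCoprimeAway A a b := by
  intro l hl hla _
  have hlp := Nat.prime_iff_prime_int.1 hl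
  obtain ⟨q, hq, hlq⟩ := (hlp.dvd_finsetProd_iff _).1 (hlp.dvd_of_dvd_pow (hla.trans ha))
  rwa [(Nat.prime_dvd_prime_iff_eq hl (hA q hq)).1 (Int.natCast_dvd_natCast.1 hlq)]

theorem IsValueAway.swap (h : IsValueAway A u v N) : IsValueAway A v u N := by
  obtain ⟨p, hpN, hp⟩ := h
  exact ⟨p.swap, (diagForm_swap v u p).trans hpN, hp.symm⟩

theorem IsValueAway.of_prime_mul (hq : q.Prime) (hqv : ¬ (q : ℤ) ∣ v)
    (h : IsValueAway A (q * u) v (q * N)) : IsValueAway A u (q * v) N := by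
  obtain ⟨⟨x, y⟩, hpN, hp⟩ := h
  have hqp := Nat.prime_iff_prime_int.1 hq
  simp only [diagForm] at hpN hp
  have hvy : (q : ℤ) ∣ v * y ^ 2 := ⟨N - u * x ^ 2, by linear_combination hpN⟩
  obtain ⟨y', rfl⟩ := hqp.dvd_of_dvd_pow ((hqp.dvd_or_dvd hvy).resolve_left hqv)
  refine ⟨(x, y'), mul_left_cancel₀ hqp.ne_zero ?_, hp.of_dvd ⟨q, by ring⟩ ⟨1, by ring⟩⟩
  simp only [diagForm]
  linear_combination hpN

theorem exists_descent_of_ramified (hq : q.Prime) (hqk : (q : ℤ) ∣ u * v)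
    (hqk2 : ¬ (q : ℤ) ^ 2 ∣ u * v) (hu : 0 < u) (hv : 0 < v) (h : IsValueAway A u v (q * N)) :
    ∃ u' v' : ℤ, 0 < u' ∧ 0 < v' ∧ u' * v' = u * v ∧ IsValueAway A u' v' N ∧
      (diagReps u v (q * N)).ncard = (diagReps u' v' N).ncard := by
  have hq0 : (0 : ℤ) < q := by exact_mod_cast hq.pos
  wlog hqu : (q : ℤ) ∣ u generalizing u v
  · rw [mul_comm] at hqk hqk2
    obtain ⟨u', v', hu', hv', huv', h', hcard⟩ := this hqk hqk2 hv hu h.swap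
      (((Nat.prime_iff_prime_int.1 hq).dvd_or_dvd hqk).resolve_right hqu)
    exact ⟨u', v', hu', hv', huv'.trans (mul_comm _ _), h', ncard_diagReps_comm.trans hcard⟩
  obtain ⟨u', rfl⟩ := hqu
  have hqv : ¬ (q : ℤ) ∣ v := fun ⟨w, hw⟩ => hqk2 ⟨u' * w, by rw [hw]; ring⟩
  exact ⟨u', q * v, pos_of_mul_pos_right hu hq0.le, mul_pos hq0 hv, by ring,
    h.of_prime_mul hq hqv, ncard_diagReps_prime_mul hq hqv⟩

theorem dvd_of_dvd_diagForm (hq : q.Prime) (hk : ∀ x < q, ¬ (q : ℤ) ∣ (x : ℤ) ^ 2 + u * v)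
    {p : ℤ × ℤ} (h : (q : ℤ) ∣ diagForm u v p) : (q : ℤ) ∣ p.1 ∧ (q : ℤ) ∣ p.2 := by
  have := Fact.mk hq
  have hroot : ∀ r : ZMod q, r ^ 2 + u * v ≠ 0 := fun r hr =>
    hk r.val r.val_lt ((ZMod.intCast_zmod_eq_zero_iff_dvd _ q).1 (by simpa using hr))
  obtain ⟨x, y⟩ := p
  simp only [← ZMod.intCast_zmod_eq_zero_iff_dvd, diagForm] at h ⊢
  push_cast at h
  have hy : (y : ZMod q) = 0 := by
    by_contra hy
    refine hroot (u * x / y) ?_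
    field_simp
    linear_combination (u : ZMod q) * h
  have hu : (u : ZMod q) ≠ 0 := fun hu => hroot 0 (by simp [hu])
  exact ⟨by simpa [hy, hu] using h, hy⟩

theorem IsValueAway.of_inert (hq : q.Prime) (hk : ∀ x < q, ¬ (q : ℤ) ∣ (x : ℤ) ^ 2 + u * v)
    (h : IsValueAway A u v (q * N)) : ∃ L, N = q * L ∧ IsValueAway A u v L := by
  obtain ⟨⟨x, y⟩, hpN, hp⟩ := h
  obtain ⟨⟨x', rfl⟩, ⟨y', rfl⟩⟩ := dvd_of_dvd_diagForm hq hk ⟨N, hpN⟩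
  refine ⟨diagForm u v (x', y'), ?_, (x', y'), rfl, hp.of_dvd ⟨q, by ring⟩ ⟨q, by ring⟩⟩
  refine mul_left_cancel₀ (by exact_mod_cast hq.ne_zero : (q : ℤ) ≠ 0) ?_
  rw [← hpN]
  simp only [diagForm]
  ring

theorem ncard_diagReps_eq_two_mul_numDivisorsAway {N : ℕ} {k : ℤ}
    (hA : ∀ q ∈ A, q.Prime ∧ IsNonsplitFor q k) (h2 : 2 ∣ k) (hcl : OneClassInPrincipalGenus k)
    (hN : N ≠ 0) (hu : 0 < u) (hv : 0 < v) (huv : u * v = k) (h : IsValueAway A u v N) :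
    (diagReps u v N).ncard = 2 * numDivisorsAway A N := by
  induction N using Nat.strong_induction_on generalizing u v with
  | _ N ih =>
  by_cases hex : ∃ q ∈ A, q ∣ N
  · obtain ⟨q, hqA, M, rfl⟩ := hex
    obtain ⟨hq, hram | hin⟩ := hA q hqA
    · have hM : M ≠ 0 := right_ne_zero_of_mul hN
      push_cast at h ⊢
      obtain ⟨u', v', hu', hv', huv', h', hcard⟩ :=
        exists_descent_of_ramified hq (huv ▸ hram.1) (huv ▸ hram.2) hu hv h
      rw [hcard, numDivisorsAway_prime_mul hq hqA hM]
      exact ih M (lt_mul_left hM.bot_lt hq.one_lt) hM hu' hv' (huv'.trans huv) h'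
    · push_cast at h
      obtain ⟨L, hL, h'⟩ := h.of_inert hq (huv ▸ hin)
      obtain ⟨L, rfl⟩ : q ∣ M := Int.natCast_dvd_natCast.1 ⟨L, hL⟩
      have hqL : q * L ≠ 0 := right_ne_zero_of_mul hN
      have hL0 : L ≠ 0 := right_ne_zero_of_mul hqL
      have hq0 : (q : ℤ) ≠ 0 := by exact_mod_cast hq.ne_zero
      push_cast at hL ⊢
      obtain rfl := mul_left_cancel₀ hq0 hL
      rw [ncard_diagReps_sq_mul hq0 fun _ => dvd_of_dvd_diagForm hq (huv ▸ hin),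
        numDivisorsAway_prime_mul hq hqA hqL, numDivisorsAway_prime_mul hq hqA hL0]
      exact ih L ((lt_mul_left hL0.bot_lt hq.one_lt).trans
        (lt_mul_left hqL.bot_lt hq.one_lt)) hL0 hu hv huv h'
  · push Not at hex
    obtain ⟨p, hpN, hp⟩ := h
    rw [numDivisorsAway_eq_card_divisors hN hex]
    refine ncard_diagReps_of_isCoprime hu hv (huv ▸ h2) hN hpN (hp.isCoprime ?_) (huv ▸ hcl)
    intro q hqA hqx hqy
    refine hex q hqA (Int.natCast_dvd_natCast.1 (hpN ▸ dvd_add ?_ ?_))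
    · exact (hqx.mul_right p.1).trans (dvd_of_eq (by ring))
    · exact (hqy.mul_right p.2).trans (dvd_of_eq (by ring))

end Descent

section ClassNumber

theorem sq_add_mul_sq_ne_mul_sq {p : ℕ} {a k x y z : ℤ} (hp : p.Prime)
    (ha : ¬ IsSquare (a : ZMod p)) (hk : (p : ℤ) ∣ k) (hz : IsCoprime z k) :
    x ^ 2 + k * y ^ 2 ≠ a * z ^ 2 := by
  intro h
  have := Fact.mk hp
  have hz0 : (z : ZMod p) ≠ 0 := fun h0 => (Nat.prime_iff_prime_int.1 hp).not_isUnit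
    (hz.isUnit_of_dvd' ((ZMod.intCast_zmod_eq_zero_iff_dvd z p).1 h0) hk)
  have hmod := congrArg (Int.cast : ℤ → ZMod p) h
  push_cast at hmod
  rw [(ZMod.intCast_zmod_eq_zero_iff_dvd k p).2 hk] at hmod
  refine ha ⟨x / z, ?_⟩
  field_simp
  linear_combination -hmod

theorem oneClassInPrincipalGenus_of_forall_le {k B : ℕ} (hB : 4 * k < 3 * (B + 1) ^ 2)
    (hred : ∀ a ≤ B, ∀ b ≤ a / 2, a ∣ b ^ 2 + k → a ^ 2 ≤ b ^ 2 + k → a ≤ 2)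
    (hgenus : 2 < k → ∀ x y z : ℤ, IsCoprime z (2 * k) → x ^ 2 + k * y ^ 2 ≠ 2 * z ^ 2) :
    OneClassInPrincipalGenus k := by
  intro a b c ha hac hba habc
  lift a to ℕ using ha.le
  lift c to ℕ using ha.le.trans hac
  rw [← Int.natAbs_sq] at habc
  rw [Int.abs_eq_natAbs] at hba
  generalize b.natAbs = b at hba habc
  have hk : a * c = b ^ 2 + k := by zify; linarith
  norm_cast at hac hba
  have hsq : a ^ 2 ≤ b ^ 2 + k := by rw [← hk, sq]; gcongr
  have hbsq : (2 * b) ^ 2 ≤ a ^ 2 := by gcongr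
  -- A reduced form satisfies `3 * a ^ 2 ≤ 4 * k`.
  have haB : a ≤ B := by
    by_contra! hlt
    have : (B + 1) ^ 2 ≤ a ^ 2 := by gcongr; omega
    linarith
  obtain rfl | rfl : a = 1 ∨ a = 2 := by
    have := hred a haB b (by omega) ⟨c, hk.symm⟩ hsq
    omega
  · exact Or.inl rfl
  · exact Or.inr fun x y z hz => hgenus (by linarith) x y z hz

theorem oneClassInPrincipalGenus_two : OneClassInPrincipalGenus 2 :=
  oneClassInPrincipalGenus_of_forall_le (B := 1) (by norm_num) (by decide) (by norm_num)

theorem oneClassInPrincipalGenus_four : OneClassInPrincipalGenus 4 := by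
  refine oneClassInPrincipalGenus_of_forall_le (B := 2) (by norm_num) (by decide)
    fun _ x y z hz h => ?_
  push_cast at hz h
  obtain ⟨x', rfl⟩ : Even x := (Int.even_pow' two_ne_zero).1 ⟨z ^ 2 - 2 * y ^ 2, by linarith⟩
  have hz2 : Even z := (Int.even_pow' two_ne_zero).1 ⟨x' ^ 2 + y ^ 2, by linarith⟩
  exact Int.prime_two.not_isUnit (hz.isUnit_of_dvd' hz2.two_dvd (by norm_num))

theorem oneClassInPrincipalGenus_two_mul {p : ℕ} (hp : p = 3 ∨ p = 5 ∨ p = 11 ∨ p = 29) :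
    OneClassInPrincipalGenus (2 * p) := by
  have hpp : p.Prime := by rcases hp with rfl | rfl | rfl | rfl <;> norm_num
  have h2 : ¬ IsSquare ((2 : ℤ) : ZMod p) := by
    rcases hp with rfl | rfl | rfl | rfl <;> decide
  have hB : ∃ B, 4 * (2 * p) < 3 * (B + 1) ^ 2 ∧ ∀ a ≤ B, ∀ b ≤ a / 2, a ∣ b ^ 2 + 2 * p →
      a ^ 2 ≤ b ^ 2 + 2 * p → a ≤ 2 := by
    rcases hp with rfl | rfl | rfl | rfl
    · exact ⟨2, by decide⟩
    · exact ⟨3, by decide⟩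
    · exact ⟨5, by decide⟩
    · exact ⟨8, by decide⟩
  obtain ⟨B, hB, hred⟩ := hB
  exact_mod_cast oneClassInPrincipalGenus_of_forall_le hB hred fun _ x y z hz =>
    sq_add_mul_sq_ne_mul_sq hpp h2 ⟨2, by push_cast; ring⟩ hz.of_mul_right_right

end ClassNumber

theorem polygonal_zero (m : ℕ) : polygonal m 0 = 0 := by
  simp [polygonal]

theorem polygonal_nonneg {m : ℕ} (hm : 3 ≤ m) (c : ℤ) : 0 ≤ polygonal m c := by
  have h : 2 * polygonal m c = (m - 3) * (c ^ 2 - c) + (c ^ 2 + c) := by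
    rw [two_mul_polygonal]; ring
  have hsub : 0 ≤ c ^ 2 - c := sub_nonneg.2 (Int.le_self_sq c)
  have hadd : 0 ≤ c ^ 2 + c := by linarith [Int.le_self_sq (-c), neg_sq c]
  have hm' : 0 ≤ (m : ℤ) - 3 := by omega
  linarith [mul_nonneg hm' hsub]

theorem exists_isPolygonalIndex {m : ℕ} {c : ℤ} (hm : 3 ≤ m) (hc : 0 < polygonal m c) :
    ∃ c', IsPolygonalIndex m c' ∧ polygonal m c' = polygonal m c := by
  have h := two_mul_polygonal m c
  have hc0 : c ≠ 0 := by
    rintro rfl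
    exact hc.ne' (polygonal_zero m)
  obtain rfl | rfl | hm5 : m = 3 ∨ m = 4 ∨ 5 ≤ m := by omega
  · rcases hc0.lt_or_gt with hneg | hpos
    · have h' := two_mul_polygonal 3 (-1 - c)
      push_cast at h h'
      refine ⟨-1 - c, fun _ => ?_, by linarith⟩
      by_contra! hle
      obtain rfl : c = -1 := by omega
      omega
    · exact ⟨c, fun _ => hpos, rfl⟩
  · have h' := two_mul_polygonal 4 |c|
    have hsq := sq_abs c
    push_cast at h h'
    exact ⟨|c|, fun _ => abs_pos.2 hc0, by linarith⟩
  · exact ⟨c, fun hm4 => by omega, rfl⟩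

/-- The differences `y = b - a`, of both signs, of the decompositions `n = a + b` with
`a * b = t * P(m, c)`, stated through `4 * a * b = n ^ 2 - y ^ 2`. Unlike in `polygonalReps` the
index `c = 0`, and with it `y = ± n`, is allowed. -/
def polygonalDiffs (m t n : ℕ) : Set ℤ :=
  {y | ∃ c : ℤ, (n : ℤ) ^ 2 - y ^ 2 = 4 * (t * polygonal m c)}

section Differences

variable {m t n : ℕ} {y : ℤ}

theorem mem_polygonalDiffs :
    y ∈ polygonalDiffs m t n ↔ ∃ c : ℤ, (n : ℤ) ^ 2 - y ^ 2 = 4 * (t * polygonal m c) :=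
  Iff.rfl

theorem abs_le_of_mem_polygonalDiffs (hm : 3 ≤ m) (hy : y ∈ polygonalDiffs m t n) : |y| ≤ n := by
  obtain ⟨c, hc⟩ := hy
  have : 0 ≤ (t : ℤ) * polygonal m c := mul_nonneg (by positivity) (polygonal_nonneg hm c)
  exact abs_le_of_sq_le_sq (by linarith) (by positivity)

theorem polygonalDiffs_finite (hm : 3 ≤ m) : (polygonalDiffs m t n).Finite :=
  (Set.finite_Icc (-n : ℤ) n).subset fun _ hy => abs_le.1 (abs_le_of_mem_polygonalDiffs hm hy)

theorem neg_mem_polygonalDiffs (hy : y ∈ polygonalDiffs m t n) : -y ∈ polygonalDiffs m t n := by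
  simpa only [mem_polygonalDiffs, neg_sq] using hy

theorem self_mem_polygonalDiffs : (n : ℤ) ∈ polygonalDiffs m t n :=
  ⟨0, by simp [polygonal_zero]⟩

theorem exists_mem_polygonalReps (hm : 3 ≤ m) (hy : y ∈ polygonalDiffs m t n) (hy0 : 0 ≤ y)
    (hyn : y ≠ n) : ∃ q ∈ polygonalReps m t n, (q.2 : ℤ) - q.1 = y := by
  have hlt : y < n :=
    lt_of_le_of_ne ((le_abs_self y).trans (abs_le_of_mem_polygonalDiffs hm hy)) hyn
  obtain ⟨c, hc⟩ := hy
  have hpos : 0 < polygonal m c := by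
    have : 0 < (t : ℤ) * polygonal m c := by nlinarith
    exact pos_of_mul_pos_right this (by positivity)
  obtain ⟨c', hc', hcc'⟩ := exists_isPolygonalIndex hm hpos
  have heven : Even ((n : ℤ) - y) := by
    have : Even ((n : ℤ) ^ 2 - y ^ 2) := ⟨2 * (t * polygonal m c), by linarith⟩
    simpa [Int.even_sub, Int.even_pow] using this
  obtain ⟨a, ha⟩ := heven
  lift a to ℕ using by omega
  lift y to ℕ using hy0
  refine ⟨(a, a + y), ⟨by simp only; omega, by simp, by simp only; omega, c', hc', ?_⟩, by simp⟩
  obtain rfl : n = a + a + y := by omega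
  push_cast at hc ⊢
  rw [hcc']
  linarith

theorem sub_mem_polygonalDiffs {q : ℕ × ℕ} (hq : q ∈ polygonalReps m t n) :
    (q.2 : ℤ) - q.1 ∈ polygonalDiffs m t n := by
  obtain ⟨_, _, hn, c, _, hc⟩ := hq
  refine ⟨c, ?_⟩
  rw [← hc, hn]
  push_cast
  ring

theorem polygonalRepCount_add_one (hm : 3 ≤ m) :
    polygonalRepCount m t n + 1 = {y ∈ polygonalDiffs m t n | 0 ≤ y}.ncard := by
  have hinj : Set.InjOn (fun q : ℕ × ℕ => (q.2 : ℤ) - q.1) (polygonalReps m t n) := by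
    rintro ⟨a, b⟩ ⟨_, _, hn, _⟩ ⟨a', b'⟩ ⟨_, _, hn', _⟩ h
    simp only [Prod.mk.injEq] at *
    omega
  have hnot : (n : ℤ) ∉ (fun q : ℕ × ℕ => (q.2 : ℤ) - q.1) '' polygonalReps m t n := by
    rintro ⟨q, ⟨ha, _, hn, _⟩, h⟩
    simp only at h
    omega
  rw [polygonalRepCount, ← hinj.ncard_image,
    ← Set.ncard_insert_of_notMem hnot ((polygonalReps_finite m t n).image _)]
  congr 1
  ext y
  constructor
  · rintro (rfl | ⟨q, hq, rfl⟩)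
    · exact ⟨self_mem_polygonalDiffs, by positivity⟩
    · exact ⟨sub_mem_polygonalDiffs hq, by simpa using hq.2.1⟩
  · rintro ⟨hy, hy0⟩
    rcases eq_or_ne y n with rfl | hyn
    · exact Set.mem_insert ..
    · exact Set.mem_insert_of_mem _ (exists_mem_polygonalReps hm hy hy0 hyn)

theorem two_mul_ncard_nonneg {S : Set ℤ} (hS : S.Finite) (hneg : ∀ y ∈ S, -y ∈ S) :
    2 * {y ∈ S | 0 ≤ y}.ncard = S.ncard + (S ∩ {0}).ncard := by
  have hnonpos : {y ∈ S | y ≤ 0}.ncard = {y ∈ S | 0 ≤ y}.ncard :=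
    Set.BijOn.ncard_eq (f := Neg.neg) ⟨fun y hy => ⟨hneg y hy.1, neg_nonneg.2 hy.2⟩,
      neg_injective.injOn, fun y hy => ⟨-y, ⟨hneg y hy.1, neg_nonpos.2 hy.2⟩, neg_neg y⟩⟩
  have hunion : {y ∈ S | y ≤ 0} ∪ {y ∈ S | 0 ≤ y} = S := by
    rw [← Set.sep_or]
    exact Set.sep_eq_self_iff_mem_true.2 fun y _ => le_total y 0
  have hinter : {y ∈ S | y ≤ 0} ∩ {y ∈ S | 0 ≤ y} = S ∩ {0} := by
    rw [← Set.sep_and]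
    ext y
    exact and_congr_right fun _ => le_antisymm_iff.symm
  have hcard := Set.ncard_union_add_ncard_inter {y ∈ S | y ≤ 0} {y ∈ S | 0 ≤ y}
    (hS.subset (Set.sep_subset ..)) (hS.subset (Set.sep_subset ..))
  rw [hunion, hinter, hnonpos] at hcard
  omega

theorem two_mul_polygonalRepCount_add_one (hm : 3 ≤ m) :
    2 * (polygonalRepCount m t n + 1) =
      (polygonalDiffs m t n).ncard + (polygonalDiffs m t n ∩ {0}).ncard := by
  rw [polygonalRepCount_add_one hm,
    two_mul_ncard_nonneg (polygonalDiffs_finite hm) fun _ => neg_mem_polygonalDiffs]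

theorem polygonalRepCount_eq_floor (hm : 3 ≤ m) :
    (polygonalRepCount m t n : ℤ) = ⌊(((polygonalDiffs m t n).ncard : ℚ) - 1) / 2⌋ := by
  have hcard := two_mul_polygonalRepCount_add_one (t := t) (n := n) hm
  have hzero : (polygonalDiffs m t n ∩ {0}).ncard ≤ 1 :=
    (Set.ncard_le_ncard Set.inter_subset_right).trans (Set.ncard_singleton 0).le
  have hlower : (2 * polygonalRepCount m t n + 1 : ℚ) ≤ (polygonalDiffs m t n).ncard := by
    exact_mod_cast (by omega)
  have hupper : ((polygonalDiffs m t n).ncard : ℚ) ≤ 2 * polygonalRepCount m t n + 2 := by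
    exact_mod_cast (by omega)
  rw [eq_comm, Int.floor_eq_iff]
  push_cast
  constructor <;> linarith

end Differences

theorem ncard_diagReps_eq_two_mul_ncard_image_snd {u v N : ℤ} (hu : 0 < u) (hv : 0 < v)
    (hx : ∀ q ∈ diagReps u v N, q.1 ≠ 0) :
    (diagReps u v N).ncard = 2 * (Prod.snd '' diagReps u v N).ncard := by
  refine ncard_eq_mul_ncard_of_fiber (diagReps_finite hu hv) ((diagReps_finite hu hv).image _)
    (Set.mapsTo_image _ _) ?_
  rintro _ ⟨⟨x, y⟩, hxy, rfl⟩
  have hne : (x, y) ≠ (-x, y) := fun h => hx _ hxy (self_eq_neg.1 (Prod.ext_iff.1 h).1)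
  rw [← Set.ncard_pair hne]
  congr 1
  ext ⟨x', y'⟩
  simp only [mem_diagReps, diagForm, Set.mem_ofPred_eq, Set.mem_insert_iff,
    Set.mem_singleton_iff, Prod.mk.injEq] at hxy ⊢
  constructor
  · rintro ⟨hxy', rfl⟩
    have hsq : x' ^ 2 = x ^ 2 := mul_left_cancel₀ hu.ne' (by linarith)
    simpa using sq_eq_sq_iff_eq_or_eq_neg.1 hsq
  · rintro (⟨rfl, rfl⟩ | ⟨rfl, rfl⟩) <;> simpa using hxy

theorem ncard_polygonalDiffs_eq {m t n d : ℕ} {u v s N : ℤ} (hm : 3 ≤ m) (hu : 0 < u) (hv : 0 < v)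
    (hs : s ≠ 0) (hN : diagForm u v (s, n) = N)
    (hdiffs : ∀ y, y ∈ polygonalDiffs m t n ↔ ∃ x, diagForm u v (x, y) = N)
    (hd : (diagReps u v N).ncard = 2 * d) : (polygonalDiffs m t n).ncard = d := by
  have himage : Prod.snd '' diagReps u v N = polygonalDiffs m t n := by
    ext y
    simp [hdiffs, mem_diagReps]
  rw [ncard_diagReps_eq_two_mul_ncard_image_snd hu hv ?_, himage] at hd
  · exact mul_left_cancel₀ two_ne_zero hd
  · rintro ⟨x, y⟩ hxy rfl
    have hyn := abs_le_of_mem_polygonalDiffs hm ((hdiffs y).2 ⟨0, hxy⟩)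
    have hysq : y ^ 2 ≤ (n : ℤ) ^ 2 := sq_le_sq.2 (by simpa using hyn)
    have hvy : v * y ^ 2 ≤ v * (n : ℤ) ^ 2 := mul_le_mul_of_nonneg_left hysq hv.le
    have hus : 0 < u * s ^ 2 := by positivity
    simp only [mem_diagReps, diagForm] at hxy hN
    linarith

theorem polygonalRepCount_eq_floor_numDivisorsAway {m t n j N : ℕ} {A : Finset ℕ} {u v s : ℤ}
    (hm : 3 ≤ m) (hu : 0 < u) (hv : 0 < v) (hs : s ≠ 0) (h2 : 2 ∣ u * v)
    (hcl : OneClassInPrincipalGenus (u * v)) (hA : ∀ q ∈ A, q.Prime ∧ IsNonsplitFor q (u * v))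
    (hsA : u * s ∣ (∏ q ∈ A, (q : ℤ)) ^ j) (hN : diagForm u v (s, n) = N)
    (hdiffs : ∀ y, y ∈ polygonalDiffs m t n ↔
      ∃ x, diagForm u v (x, y) = diagForm u v (s, n)) :
    (polygonalRepCount m t n : ℤ) = ⌊((numDivisorsAway A N : ℚ) - 1) / 2⌋ := by
  have hN0 : N ≠ 0 := by
    rintro rfl
    exact hs (Prod.ext_iff.1 (eq_zero_of_diagForm_eq_zero hu hv hN)).1
  have hvalue : IsValueAway A u v N :=
    ⟨(s, n), hN, isCoprimeAway_of_dvd_prod_pow (fun q hq => (hA q hq).1) hsA⟩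
  rw [polygonalRepCount_eq_floor hm, ncard_polygonalDiffs_eq hm hu hv hs hN (hN ▸ hdiffs)
    (ncard_diagReps_eq_two_mul_numDivisorsAway hA h2 hcl hN0 hu hv rfl hvalue)]

section Families

variable {t n M : ℕ} {x y σ : ℤ}

theorem exists_sq_eq_of_dvd (hM : Odd M) (hM' : M = 1 ∨ M.Prime)
    (h : 2 * (M : ℤ) ∣ x ^ 2 - σ ^ 2) : ∃ c : ℤ, (2 * M * c - σ) ^ 2 = x ^ 2 := by
  wlog hx : (M : ℤ) ∣ x + σ generalizing x
  · obtain ⟨c, hc⟩ := this (x := -x) (by simpa using h) (by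
      have hmul : (M : ℤ) ∣ (x + σ) * (x - σ) :=
        (dvd_mul_left _ 2).trans (h.trans (dvd_of_eq (by ring)))
      rcases hM' with rfl | hM'
      · simp
      · refine (dvd_neg.2 (((Nat.prime_iff_prime_int.1 hM').dvd_or_dvd hmul).resolve_left
          hx)).trans (dvd_of_eq (by ring)))
    exact ⟨c, by simpa using hc⟩
  have heven : Even (x + σ) := by
    have : Even (x ^ 2 - σ ^ 2) := even_iff_two_dvd.2 ((dvd_mul_right 2 _).trans h)
    simpa [Int.even_sub, Int.even_add, Int.even_pow] using this
  have hcop : IsCoprime (2 : ℤ) M := by exact_mod_cast (Nat.coprime_two_left.2 hM).isCoprime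
  obtain ⟨c, hc⟩ := hcop.mul_dvd heven.two_dvd hx
  exact ⟨c, by rw [← hc]; ring⟩

theorem mem_polygonalDiffs_add_two_iff (hM : Odd M) (hM' : M = 1 ∨ M.Prime)
    (ht : IsCoprime (t : ℤ) (2 * M)) :
    y ∈ polygonalDiffs (M + 2) t n ↔
      ∃ x, diagForm t (2 * M) (x, y) = diagForm t (2 * M) ((M : ℤ) - 2, n) := by
  have hM0 : (2 * M : ℤ) ≠ 0 := by exact_mod_cast (by simpa using hM.pos.ne')
  have hsq : ∀ c, (2 * M * c - (M - 2)) ^ 2 = 4 * (2 * M) * polygonal (M + 2) c + (M - 2) ^ 2 := by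
    intro c
    have h := two_mul_polygonal (M + 2) c
    push_cast at h
    linear_combination (-4 * M : ℤ) * h
  simp only [mem_polygonalDiffs, diagForm]
  constructor
  · rintro ⟨c, hc⟩
    refine ⟨2 * M * c - (M - 2), ?_⟩
    rw [hsq]
    linear_combination (-2 * M : ℤ) * hc
  · rintro ⟨x, hx⟩
    obtain ⟨c, hc⟩ := exists_sq_eq_of_dvd (x := x) (σ := M - 2) hM hM' <|
      ht.symm.dvd_of_dvd_mul_left ⟨n ^ 2 - y ^ 2, by linear_combination hx⟩
    refine ⟨c, mul_left_cancel₀ hM0 ?_⟩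
    linear_combination -hx - t * hc + t * hsq c

theorem mem_polygonalDiffs_two_mul_add_two_iff (hM : Odd M) (hM' : M = 1 ∨ M.Prime) :
    y ∈ polygonalDiffs (2 * M + 2) 2 n ↔
      ∃ x, diagForm 2 M (x, y) = diagForm 2 M ((M : ℤ) - 1, n) := by
  have hM0 : (M : ℤ) ≠ 0 := by exact_mod_cast hM.pos.ne'
  have hsq : ∀ c, (2 * M * c - (M - 1)) ^ 2 = 4 * M * polygonal (2 * M + 2) c + (M - 1) ^ 2 := by
    intro c
    have h := two_mul_polygonal (2 * M + 2) c
    push_cast at h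
    linear_combination (-2 * M : ℤ) * h
  simp only [mem_polygonalDiffs, diagForm]
  constructor
  · rintro ⟨c, hc⟩
    refine ⟨2 * M * c - (M - 1), ?_⟩
    rw [hsq]
    push_cast at hc
    linear_combination (-M : ℤ) * hc
  · rintro ⟨x, hx⟩
    have hcop : IsCoprime (2 : ℤ) M := by exact_mod_cast (Nat.coprime_two_left.2 hM).isCoprime
    obtain ⟨i, hi⟩ : (2 : ℤ) ∣ n - y := by
      have hdvd : (2 : ℤ) ∣ n ^ 2 - y ^ 2 :=
        hcop.dvd_of_dvd_mul_left ⟨x ^ 2 - (M - 1) ^ 2, by linear_combination -hx⟩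
      rw [← even_iff_two_dvd] at hdvd ⊢
      simpa [Int.even_sub, Int.even_pow] using hdvd
    obtain rfl : y = n - 2 * i := by omega
    obtain ⟨c, hc⟩ := exists_sq_eq_of_dvd (x := x) (σ := M - 1) hM hM'
      ⟨n * i - i ^ 2, by linarith⟩
    refine ⟨c, mul_left_cancel₀ hM0 ?_⟩
    push_cast
    linear_combination -hx - 2 * hc + 2 * hsq c

end Families

section Evaluations

variable {n p j : ℕ} {A : Finset ℕ}

theorem polygonalRepCount_add_two_one (hp : p.Prime) (hodd : Odd p)
    (hcl : OneClassInPrincipalGenus (2 * p)) (hA : ∀ q ∈ A, q.Prime ∧ IsNonsplitFor q (2 * p))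
    (hpA : p - 2 ∣ (∏ q ∈ A, q) ^ j) :
    (polygonalRepCount (p + 2) 1 n : ℤ) =
      ⌊((numDivisorsAway A (2 * p * n ^ 2 + (p - 2) ^ 2) : ℚ) - 1) / 2⌋ := by
  have hp2 : 2 < p := hp.two_le.lt_of_ne' (by rintro rfl; exact absurd hodd (by decide))
  have hsub : ((p - 2 : ℕ) : ℤ) = p - 2 := by push_cast [hp2.le]; ring
  refine polygonalRepCount_eq_floor_numDivisorsAway (j := j) (u := (1 : ℕ)) (v := 2 * p)
    (s := (p : ℤ) - 2) (by omega) (by simp) (by omega) (by omega) (by simp)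
    (by simpa using hcl) (by simpa using hA) ?_ ?_ fun y =>
    mem_polygonalDiffs_add_two_iff hodd (Or.inr hp) (by simpa using isCoprime_one_left)
  · simpa [hsub] using Int.natCast_dvd_natCast.2 hpA
  · push_cast [hsub, diagForm]
    ring

theorem polygonalRepCount_two_mul_add_two (hp : p.Prime) (hodd : Odd p)
    (hcl : OneClassInPrincipalGenus (2 * p)) (hA : ∀ q ∈ A, q.Prime ∧ IsNonsplitFor q (2 * p))
    (hpA : 2 * (p - 1) ∣ (∏ q ∈ A, q) ^ j) :
    (polygonalRepCount (2 * p + 2) 2 n : ℤ) =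
      ⌊((numDivisorsAway A (p * n ^ 2 + 2 * (p - 1) ^ 2) : ℚ) - 1) / 2⌋ := by
  have hp2 : 2 ≤ p := hp.two_le
  have hsub : ((p - 1 : ℕ) : ℤ) = p - 1 := by push_cast [hp.one_le]; ring
  refine polygonalRepCount_eq_floor_numDivisorsAway (j := j) (u := 2) (v := p) (s := (p : ℤ) - 1)
    (by omega) (by simp) (by omega) (by omega) (by simp) hcl
    hA ?_ ?_ fun y => mem_polygonalDiffs_two_mul_add_two_iff hodd (Or.inr hp)
  · simpa [hsub] using Int.natCast_dvd_natCast.2 hpA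
  · push_cast [hsub, diagForm]
    ring

theorem polygonalRepCount_three_of_odd {t : ℕ} (ht : Odd t)
    (hA : ∀ q ∈ A, q.Prime ∧ IsNonsplitFor q (2 * t)) (htA : t ∣ (∏ q ∈ A, q) ^ j)
    (hcl : OneClassInPrincipalGenus (2 * t)) :
    (polygonalRepCount 3 t n : ℤ) = ⌊((numDivisorsAway A (2 * n ^ 2 + t) : ℚ) - 1) / 2⌋ := by
  have hcop : IsCoprime (t : ℤ) 2 := by exact_mod_cast (Nat.coprime_two_right.2 ht).isCoprime
  rw [mul_comm] at hcl
  refine polygonalRepCount_eq_floor_numDivisorsAway (j := j) (u := t) (v := 2 * (1 : ℕ))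
    (s := ((1 : ℕ) : ℤ) - 2) le_rfl (by exact_mod_cast ht.pos) (by simp) (by simp) (by simp)
    (by simpa using hcl) (by simpa [mul_comm] using hA) ?_ ?_ fun y =>
    mem_polygonalDiffs_add_two_iff odd_one (Or.inl rfl) (by simpa using hcop)
  · simpa using Int.natCast_dvd_natCast.2 htA
  · push_cast [diagForm]
    ring

end Evaluations

section TwiceTriangular

variable {n : ℕ}

theorem mem_polygonalDiffs_three_two_iff {y : ℤ} :
    y ∈ polygonalDiffs 3 2 n ↔ ∃ x : ℤ, Odd x ∧ x ^ 2 + y ^ 2 = n ^ 2 + 1 := by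
  have htri (c : ℤ) : 2 * polygonal 3 c = c ^ 2 + c := by
    rw [two_mul_polygonal]
    push_cast
    ring
  rw [mem_polygonalDiffs]
  constructor
  · rintro ⟨c, hc⟩
    refine ⟨2 * c + 1, odd_two_mul_add_one c, ?_⟩
    push_cast at hc
    linear_combination -hc - 4 * htri c
  · rintro ⟨_, ⟨c, rfl⟩, hc⟩
    refine ⟨c, ?_⟩
    push_cast
    linear_combination -hc - 4 * htri c

theorem zero_notMem_polygonalDiffs_three_two (hn : 0 < n) : (0 : ℤ) ∉ polygonalDiffs 3 2 n := by
  rw [mem_polygonalDiffs_three_two_iff]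
  rintro ⟨x, -, hx⟩
  have hlt : (n : ℤ) < |x| := by
    rw [← Nat.abs_cast n, ← sq_lt_sq]
    linarith
  have hsq := sq_abs x
  nlinarith

theorem ncard_polygonalDiffs_three_two_of_even (w : ℕ) :
    (polygonalDiffs 3 2 (2 * w)).ncard = ((2 * w) ^ 2 + 1).divisors.card := by
  have hodd {q : ℤ × ℤ} (hq : q ∈ diagReps 1 4 ((2 * w) ^ 2 + 1 : ℕ)) : Odd q.1 := by
    have hmod : q.1 ^ 2 = 2 * (2 * w ^ 2 - 2 * q.2 ^ 2) + 1 := by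
      rw [mem_diagReps, diagForm] at hq
      push_cast at hq
      linarith
    exact (Int.odd_pow' two_ne_zero).1 ⟨_, hmod⟩
  have himage : (2 * ·) '' (Prod.snd '' diagReps 1 4 ((2 * w) ^ 2 + 1 : ℕ)) =
      polygonalDiffs 3 2 (2 * w) := by
    ext y
    rw [mem_polygonalDiffs_three_two_iff]
    constructor
    · rintro ⟨_, ⟨q, hq, rfl⟩, rfl⟩
      refine ⟨q.1, hodd hq, ?_⟩
      rw [mem_diagReps, diagForm] at hq
      push_cast at hq ⊢
      linarith
    · rintro ⟨x, ⟨a, rfl⟩, hxy⟩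
      have hy : Even (y ^ 2) := ⟨2 * w ^ 2 - 2 * a ^ 2 - 2 * a, by push_cast at hxy; linarith⟩
      obtain ⟨b, rfl⟩ := ((Int.even_pow' two_ne_zero).1 hy).two_dvd
      refine ⟨b, ⟨(2 * a + 1, b), ?_, rfl⟩, rfl⟩
      rw [mem_diagReps, diagForm]
      push_cast at hxy ⊢
      linarith
  have hcount : (diagReps 1 4 ((2 * w) ^ 2 + 1 : ℕ)).ncard =
      2 * ((2 * w) ^ 2 + 1).divisors.card :=
    ncard_diagReps_of_isCoprime (p := (1, w)) one_pos four_pos (by norm_num) (by positivity)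
      (by simp only [diagForm]; push_cast; ring) (by simpa using isCoprime_one_left)
      oneClassInPrincipalGenus_four
  have hfiber := ncard_diagReps_eq_two_mul_ncard_image_snd (u := 1) (v := 4)
    (N := ((2 * w) ^ 2 + 1 : ℕ)) one_pos four_pos fun q hq h => by simpa [h] using hodd hq
  rw [← himage, Set.ncard_image_of_injective _ (mul_right_injective₀ two_ne_zero)]
  omega

theorem ncard_diagReps_one_four_of_consecutive (w : ℕ) :
    (diagReps 1 4 (w ^ 2 + (w + 1) ^ 2 : ℕ)).ncard =
      2 * (w ^ 2 + (w + 1) ^ 2).divisors.card := by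
  obtain ⟨p, hp, hcop⟩ : ∃ p : ℤ × ℤ, diagForm 1 4 p = (w ^ 2 + (w + 1) ^ 2 : ℕ) ∧
      IsCoprime (1 * p.1) (4 * p.2) := by
    rcases Nat.even_or_odd' w with ⟨z, rfl | rfl⟩
    · refine ⟨(2 * z + 1, z), by simp only [diagForm]; push_cast; ring, ?_⟩
      have h2 : IsCoprime (2 * z + 1 : ℤ) (2 * z) := ⟨1, -1, by ring⟩
      simpa [show (4 * z : ℤ) = 2 * (2 * z) by ring] using
        (h2.of_isCoprime_of_dvd_right (dvd_mul_right 2 _)).mul_right h2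
    · refine ⟨(2 * z + 1, z + 1), by simp only [diagForm]; push_cast; ring, ?_⟩
      have h2 : IsCoprime (2 * z + 1 : ℤ) (2 * (z + 1)) := ⟨-1, 1, by ring⟩
      simpa [show (4 * (z + 1) : ℤ) = 2 * (2 * (z + 1)) by ring] using
        (h2.of_isCoprime_of_dvd_right (dvd_mul_right 2 _)).mul_right h2
  exact ncard_diagReps_of_isCoprime one_pos four_pos (by norm_num) (by positivity) hp hcop
    oneClassInPrincipalGenus_four

theorem exists_add_four_mul_sq_eq {x y : ℤ} (hx : Odd x) (hy : Odd y) :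
    ∃ b, (x + 4 * b) ^ 2 = y ^ 2 := by
  obtain ⟨c, rfl⟩ := hx
  obtain ⟨d, rfl⟩ := hy
  obtain ⟨e, he | he⟩ := Int.even_or_odd' (d - c)
  · exact ⟨e, by rw [show d = c + 2 * e by omega]; ring⟩
  · exact ⟨-c - e - 1, by rw [show d = c + (2 * e + 1) by omega]; ring⟩

theorem ncard_polygonalDiffs_three_two_of_odd (w : ℕ) :
    (polygonalDiffs 3 2 (2 * w + 1)).ncard = ((2 * w + 1) ^ 2 + 1).divisors.card := by
  have hmul : (2 * w + 1) ^ 2 + 1 = 2 * (w ^ 2 + (w + 1) ^ 2) := by ring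
  have hcop : Nat.Coprime 2 (w ^ 2 + (w + 1) ^ 2) :=
    Nat.coprime_two_left.2 ⟨w ^ 2 + w, by ring⟩
  rw [hmul, hcop.card_divisors_mul, Nat.prime_two.divisors, Finset.card_pair (by norm_num),
    ← ncard_diagReps_one_four_of_consecutive]
  symm
  have hform {a b : ℤ} (hab : (a, b) ∈ diagReps 1 4 (w ^ 2 + (w + 1) ^ 2 : ℕ)) :
      (a + 2 * b) ^ 2 + (a - 2 * b) ^ 2 = (2 * w + 1) ^ 2 + 1 ∧ Odd a := by
    simp only [mem_diagReps, diagForm] at hab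
    push_cast at hab
    have hmod : a ^ 2 = 2 * (w ^ 2 + w - 2 * b ^ 2) + 1 := by linarith
    exact ⟨by linarith, (Int.odd_pow' two_ne_zero).1 ⟨_, hmod⟩⟩
  refine Set.BijOn.ncard_eq (f := fun q => q.1 - 2 * q.2) ⟨?_, ?_, ?_⟩
  · rintro ⟨a, b⟩ hab
    obtain ⟨hsum, ha⟩ := hform hab
    exact mem_polygonalDiffs_three_two_iff.2
      ⟨a + 2 * b, ha.add_even (even_two_mul b), by exact_mod_cast hsum⟩
  · rintro ⟨a, b⟩ hab ⟨a', b'⟩ hab' h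
    obtain ⟨hsum, -⟩ := hform hab
    obtain ⟨hsum', c, rfl⟩ := hform hab'
    simp only [Prod.mk.injEq] at h ⊢
    rw [h] at hsum
    rcases sq_eq_sq_iff_eq_or_eq_neg.1 (add_right_cancel (hsum.trans hsum'.symm)) with h' | h'
    · omega
    · omega
  · intro y hy
    obtain ⟨x, hx, hxy⟩ := mem_polygonalDiffs_three_two_iff.1 hy
    have hy' : Odd y := by
      have hodd : Odd (x ^ 2 + y ^ 2 + 1) := ⟨2 * w ^ 2 + 2 * w + 1, by rw [hxy]; push_cast; ring⟩
      have hx2 : ¬Even x := Int.not_even_iff_odd.2 hx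
      simpa [← Int.not_even_iff_odd, Int.even_add, Int.even_pow, hx2] using hodd
    obtain ⟨b, hb⟩ := exists_add_four_mul_sq_eq hy' hx
    refine ⟨(y + 2 * b, b), ?_, by simp⟩
    simp only [mem_diagReps, diagForm]
    push_cast at hxy ⊢
    linarith

theorem polygonalRepCount_three_two (hn : 0 < n) :
    (polygonalRepCount 3 2 n : ℚ) = ((n ^ 2 + 1).divisors.card : ℚ) / 2 - 1 := by
  have hcard : (polygonalDiffs 3 2 n).ncard = (n ^ 2 + 1).divisors.card := by
    obtain ⟨w, rfl | rfl⟩ := Nat.even_or_odd' n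
    · exact ncard_polygonalDiffs_three_two_of_even w
    · exact ncard_polygonalDiffs_three_two_of_odd w
  have h := two_mul_polygonalRepCount_add_one (t := 2) (n := n) le_rfl
  rw [Set.inter_singleton_eq_empty.2 (zero_notMem_polygonalDiffs_three_two hn), Set.ncard_empty,
    add_zero, hcard] at h
  rw [← h]
  push_cast
  ring

end TwiceTriangular

theorem theorem3 (n : ℕ) (hn : 0 < n) :
    (polygonalRepCount 3 1 n : ℤ) = ⌊(((2 * n ^ 2 + 1).divisors.card : ℚ) - 1) / 2⌋ ∧
    (polygonalRepCount 5 1 n : ℤ) = ⌊(((6 * n ^ 2 + 1).divisors.card : ℚ) - 1) / 2⌋ ∧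
    (polygonalRepCount 7 1 n : ℤ) = ⌊((numDivisorsAway {3} (10 * n ^ 2 + 9) : ℚ) - 1) / 2⌋ ∧
    (polygonalRepCount 13 1 n : ℤ) = ⌊((numDivisorsAway {3} (22 * n ^ 2 + 81) : ℚ) - 1) / 2⌋ ∧
    (polygonalRepCount 31 1 n : ℤ) = ⌊((numDivisorsAway {3} (58 * n ^ 2 + 729) : ℚ) - 1) / 2⌋ ∧
    (polygonalRepCount 3 2 n : ℚ) = ((n ^ 2 + 1).divisors.card : ℚ) / 2 - 1 ∧
    (polygonalRepCount 8 2 n : ℤ) = ⌊((numDivisorsAway {2} (3 * n ^ 2 + 8) : ℚ) - 1) / 2⌋ ∧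
    (polygonalRepCount 12 2 n : ℤ) = ⌊((numDivisorsAway {2} (5 * n ^ 2 + 32) : ℚ) - 1) / 2⌋ ∧
    (polygonalRepCount 24 2 n : ℤ) = ⌊((numDivisorsAway {2, 5} (11 * n ^ 2 + 200) : ℚ) - 1) / 2⌋ ∧
    (polygonalRepCount 60 2 n : ℤ) =
      ⌊((numDivisorsAway {2, 7} (29 * n ^ 2 + 1568) : ℚ) - 1) / 2⌋ ∧
    (polygonalRepCount 3 3 n : ℤ) = ⌊((numDivisorsAway {3} (2 * n ^ 2 + 3) : ℚ) - 1) / 2⌋ ∧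
    (polygonalRepCount 3 5 n : ℤ) = ⌊((numDivisorsAway {5} (2 * n ^ 2 + 5) : ℚ) - 1) / 2⌋ ∧
    (polygonalRepCount 3 11 n : ℤ) = ⌊((numDivisorsAway {11} (2 * n ^ 2 + 11) : ℚ) - 1) / 2⌋ ∧
    (polygonalRepCount 3 29 n : ℤ) = ⌊((numDivisorsAway {29} (2 * n ^ 2 + 29) : ℚ) - 1) / 2⌋ := by
  have hdivisors (k : ℕ) : numDivisorsAway ∅ (k + 1) = (k + 1).divisors.card :=
    numDivisorsAway_empty k.succ_ne_zero
  simp only [← hdivisors (2 * n ^ 2), ← hdivisors (6 * n ^ 2)]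
  refine ⟨?_, ?_, ?_, ?_, ?_, polygonalRepCount_three_two hn, ?_, ?_, ?_, ?_, ?_, ?_, ?_, ?_⟩
  · exact polygonalRepCount_three_of_odd (j := 0) odd_one (by simp) (by simp)
      oneClassInPrincipalGenus_two
  · exact polygonalRepCount_add_two_one (p := 3) (j := 0) (by norm_num) (by decide)
      (oneClassInPrincipalGenus_two_mul (by simp)) (by simp) (by simp)
  · exact polygonalRepCount_add_two_one (p := 5) (j := 1) (by norm_num) (by decide)
      (oneClassInPrincipalGenus_two_mul (by simp)) (by decide) (by decide)
  · exact polygonalRepCount_add_two_one (p := 11) (j := 2) (by norm_num) (by decide)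
      (oneClassInPrincipalGenus_two_mul (by simp)) (by decide) (by decide)
  · exact polygonalRepCount_add_two_one (p := 29) (j := 3) (by norm_num) (by decide)
      (oneClassInPrincipalGenus_two_mul (by simp)) (by decide) (by decide)
  · exact polygonalRepCount_two_mul_add_two (p := 3) (j := 2) (by norm_num) (by decide)
      (oneClassInPrincipalGenus_two_mul (by simp)) (by decide) (by decide)
  · exact polygonalRepCount_two_mul_add_two (p := 5) (j := 3) (by norm_num) (by decide)
      (oneClassInPrincipalGenus_two_mul (by simp)) (by decide) (by decide)
  · exact polygonalRepCount_two_mul_add_two (p := 11) (j := 2) (by norm_num) (by decide)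
      (oneClassInPrincipalGenus_two_mul (by simp)) (by decide) (by decide)
  · exact polygonalRepCount_two_mul_add_two (p := 29) (j := 3) (by norm_num) (by decide)
      (oneClassInPrincipalGenus_two_mul (by simp)) (by decide) (by decide)
  all_goals
    exact polygonalRepCount_three_of_odd (j := 1) (by decide) (by decide) (by decide)
      (oneClassInPrincipalGenus_two_mul (by simp))
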